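/- A cut of a finite digraph $G=(V,E)$ is a set $\emptyset\subsetneq S\subsetneq V$. A digraph is bidirected if $uv\in E$ iff $vu\in E$. An instance of Dual Power Assignment (DPA) is a finite strongly connected bidirected digraph $G=(V,E)$ with arc costs $c:E\to\{0,1\}$ satisfying $c(uv)=c(vu)$; one has to assign a power $p(v)\in\{0,1\}$ to every vertex so that the arcs $uv\in E$ with $c(uv)\le p(u)$ form a strongly connected spanning subgraph, minimizing $\sum_v p(v)$. For a cut $S$ let $\partial(S)$ be the set of pairs $(v,p)\in V\times\{0,1\}$ with $v\in S$ for which there is an arc $vw\in E$ with $w\notin S$ and $c(vw)\le p$. The cut-based linear program and its dual are $$\min \sum_{v,p} p\,x_{v,p}\quad\text{s.t. } \sum_{(v,p)\in\partial(S)}x_{v,p}\ge 1 \text{ for all cuts } S,\quad x\ge 0,$$ $$\max \sum_S y_S\quad\text{s.t. } \sum_{S:\,(v,p)\in\partial(S)}y_S\le p \text{ for all } (v,p),\quad y\ge 0.$$ An instance of Star Strong Connectivity (SSC) is a finite strongly connected digraph $G=(V,E)$ with a set $\mathcal C$ of stars (a star $F$ is a set of arcs with a common source $\mathrm{source}(F)$)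 such that $\bigcup_{F\in\mathcal C}F=E$; one has to choose a minimum-cardinality $R\subseteq\mathcal C$ such that $(V,\bigcup_{F\in R}F)$ is strongly connected. DPA is equivalent to SSC restricted to bidirected digraphs. For a cut $S$ let $\partial\mathcal C(S)$ be the set of $F\in\mathcal C$ with $\mathrm{source}(F)\in S$ and an arc of $F$ ending outside $S$. The cut-based linear program and its dual are $$\min \sum_{F\in\mathcal C} x_F\quad\text{s.t. } \sum_{F\in\partial\mathcal C(S)}x_F\ge 1 \text{ for all cuts } S,\quad x\ge 0,$$ $$\max \sum_S y_S\quad\text{s.t. } \sum_{S:\,F\in\partial\mathcal C(S)}y_S\le 1 \text{ for all } F\in\mathcal C,\quad y\ge 0.$$ The integrality gap of such a program is the supremum over all instances of the ratio of the minimum over integer feasible $x$ to the minimum over real feasible $x$ (with $0/0=0$ and $a/0=\infty$ for $a>0$). Corollary. (1) The integrality gap of the cut-based linear program for DPA is at most $3/2$. More strongly, every DPA instance has an integer primal feasible solution $x$ and an integer dual feasible solution $y$ such that the primal objective of $x$ is at most $3/2$ times the dual objective of $y$. (2) The same two statements hold for the cut-based linear program for SSC over the instances whose digraph is bidirected. 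-/

import Mathlib

open scoped ENNReal

universe u v w

/-- A digraph is strongly connected if every vertex is reachable from every vertex by a
directed path. -/
def IsStronglyConnected {V : Type u} (G : Digraph V) : Prop :=
  ∀ a b : V, Relation.ReflTransGen G.Adj a b

/-- A digraph is bidirected if `ab` is an arc if and only if `ba` is an arc. -/
def IsBidirected {V : Type u} (G : Digraph V) : Prop :=
  ∀ a b : V, G.Adj a b ↔ G.Adj b a

/-- A cut `∅ ⊂ S ⊂ V`. -/
abbrev Cut (V : Type u) : Type u := {S : Set V // S.Nonempty ∧ S ≠ Set.univ}

noncomputable instance Cut.instFintype (V : Type u) [Fintype V] : Fintype (Cut V) :=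
  Fintype.ofFinite _

/-- The data of a cut-based covering program: there is one primal variable `x j` for each `j`
(a star, or a vertex with a power level) and one constraint for each cut; `cost j` is the
objective coefficient of `x j`, and `Crosses j S` says that `x j` occurs (with coefficient `1`)
in the constraint of the cut `S`. -/
structure CutProgram (V : Type u) (J : Type v) where
  cost : J → ℝ
  Crosses : J → Cut V → Prop

namespace CutProgram

variable {V : Type u} {J : Type v} [Fintype V] [Fintype J] (P : CutProgram V J)

open Classical in
/-- Primal feasibility: `x ≥ 0` and `∑_{j crossing S} x j ≥ 1` for each cut `S`. -/
def PrimalFeasible (x : J → ℝ) : Prop :=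
  (∀ j, 0 ≤ x j) ∧ ∀ S : Cut V, 1 ≤ ∑ j with P.Crosses j S, x j

/-- The primal objective, to be minimized. -/
def primalValue (x : J → ℝ) : ℝ := ∑ j, P.cost j * x j

open Classical in
/-- Dual feasibility: `y ≥ 0` and `∑_{S crossed by j} y S ≤ cost j` for each `j`. -/
def DualFeasible (y : Cut V → ℝ) : Prop :=
  (∀ S, 0 ≤ y S) ∧ ∀ j, ∑ S with P.Crosses j S, y S ≤ P.cost j

end CutProgram

/-- The dual objective, to be maximized. -/
noncomputable def dualValue {V : Type u} [Fintype V] (y : Cut V → ℝ) : ℝ := ∑ S, y S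

/-- A vector all of whose entries are integers. -/
def IsIntegerVector {ι : Type w} (x : ι → ℝ) : Prop := ∀ i, ∃ z : ℤ, x i = z

namespace CutProgram

variable {V : Type u} {J : Type v} [Fintype V] [Fintype J] (P : CutProgram V J)

/-- The optimal value of the linear program (`⊤` if it is infeasible). The objectives of the
programs below are nonnegative on feasible points, so `ENNReal.ofReal` loses nothing. -/
noncomputable def fractionalOpt : ℝ≥0∞ :=
  ⨅ (x : J → ℝ) (_ : P.PrimalFeasible x), ENNReal.ofReal (P.primalValue x)

/-- The optimal value of the integer program (`⊤` if it is infeasible). -/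
noncomputable def integerOpt : ℝ≥0∞ :=
  ⨅ (x : J → ℝ) (_ : P.PrimalFeasible x ∧ IsIntegerVector x), ENNReal.ofReal (P.primalValue x)

/-- The ratio of the integer optimum to the fractional optimum. In `ℝ≥0∞` we have `0 / 0 = 0` and
`a / 0 = ⊤` for `a ≠ 0`, so a positive integer optimum over a zero fractional optimum counts as
an infinite ratio. -/
noncomputable def gapRatio : ℝ≥0∞ := P.integerOpt / P.fractionalOpt

/-- There are an integer primal solution and an integer dual solution such that the primal
objective is at most `ρ` times the dual objective. -/
def HasIntegerPrimalDualPair (ρ : ℝ) : Prop :=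
  ∃ (x : J → ℝ) (y : Cut V → ℝ),
    P.PrimalFeasible x ∧ IsIntegerVector x ∧ P.DualFeasible y ∧ IsIntegerVector y ∧
      P.primalValue x ≤ ρ * dualValue y

end CutProgram

/-! ### Dual Power Assignment -/

/-- An instance of Dual Power Assignment: a finite, strongly connected, bidirected digraph with
symmetric arc costs in `{0, 1}`. The values of `cost` off the arcs are irrelevant. -/
structure DPAInstance : Type (u + 1) where
  V : Type u
  [fintypeV : Fintype V]
  G : Digraph V
  cost : V → V → Fin 2
  bidirected : IsBidirected G
  cost_symm : ∀ a b, G.Adj a b → cost a b = cost b a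
  stronglyConnected : IsStronglyConnected G

attribute [instance] DPAInstance.fintypeV

/-- The vertices that `a` reaches directly when it is assigned power `p`
(`0` is low, `1` is high): the heads of the arcs out of `a` of cost at most `p`. -/
def DPAInstance.reach (I : DPAInstance.{u}) (a : I.V) (p : Fin 2) : Set I.V :=
  {b | I.G.Adj a b ∧ I.cost a b ≤ p}

/-- The cut-based linear program of Dual Power Assignment: a variable `x (a, p)` of cost `p` for
each vertex `a` and each power level `p`; each cut `S` has to be crossed by an arc that is
available at a chosen power level. -/
def DPAInstance.program (I : DPAInstance.{u}) : CutProgram I.V (I.V × Fin 2) where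
  cost j := ((j.2 : ℕ) : ℝ)
  Crosses j S := j.1 ∈ S.1 ∧ ∃ b ∈ I.reach j.1 j.2, b ∉ S.1

/-! ### Star Strong Connectivity -/

/-- A star: a set of arcs with a common source, given by its source and the set of its sinks. -/
structure ArcStar (V : Type u) where
  source : V
  sinks : Finset V

/-- An instance of Star Strong Connectivity: a finite, strongly connected digraph and a set of
stars whose union is the arc set. -/
structure SSCInstance : Type (u + 1) where
  V : Type u
  [fintypeV : Fintype V]
  G : Digraph V
  stars : Finset (ArcStar V)
  adj_iff : ∀ a b, G.Adj a b ↔ ∃ F ∈ stars, F.source = a ∧ b ∈ F.sinks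
  stronglyConnected : IsStronglyConnected G

attribute [instance] SSCInstance.fintypeV

/-- The cut-based linear program of Star Strong Connectivity: a variable of cost `1` for each
star; a star crosses `S` if its source is in `S` and at least one of its sinks is not. -/
def SSCInstance.program (I : SSCInstance.{u}) : CutProgram I.V I.stars where
  cost _ := 1
  Crosses F S := F.1.source ∈ S.1 ∧ ∃ b ∈ F.1.sinks, b ∉ S.1

/-! ### Integrality gaps -/

/-- The integrality gap of the cut-based linear program for Dual Power Assignment: the supremum
over all instances of the ratio of the integer optimum to the fractional optimum. -/
noncomputable def dpaIntegralityGap : ℝ≥0∞ := ⨆ I : DPAInstance.{u}, I.program.gapRatio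

/-- The integrality gap of the cut-based linear program for Star Strong Connectivity restricted
to instances with a bidirected digraph. -/
noncomputable def bidirectedSSCIntegralityGap : ℝ≥0∞ :=
  ⨆ (I : SSCInstance.{u}) (_ : IsBidirected I.G), I.program.gapRatio

/-! By weak duality it suffices to find, for a bidirected star family, a strongly connecting set R
of stars and a family 𝒮 of cuts, no two crossed by one star, with |R| ≤ 3/2 |𝒮|
(`exists_isStarCutPair`).

The pair is built by contracting ears (`IsStarEar`). Stars that cross either cut of an ear become
loops when Q is contracted, so these two cuts are compatible with all cuts found later
(`IsStarEar.uncontract`). An ear removes |Q| - 1 vertices and costs at most |Q| stars. Hence k ears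
reducing n vertices to one use at most n - 1 + k stars and give 2k cuts. If 2k ≥ n these cuts are
enough; otherwise the n singletons are.

The heart is `exists_isStarEar`. The last vertex of a longest path has all its neighbours on the
path, and so has `p (i + 1)` whenever `p i` is a neighbour of the last vertex, by rotation.
Singletons of such vertices serve as cuts. A closed-up segment of the path costs one star per
vertex, and the star of `p i` that jumps to the last vertex may do double duty: it also starts a
branch off the path or extends the segment downwards. Maximizing the first index of a closed path
excludes the branches that do not return to the path.

Dual Power Assignment reduces to this by contracting the components of the cost-0 arcs. -/

/-! ### Paths in a relation -/

section Paths

variable {V : Type u} {A : V → V → Prop}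

/-- The vertices `p 0, …, p s` are distinct and consecutive ones are related by `A`. -/
structure IsSeqPath (A : V → V → Prop) (p : ℕ → V) (s : ℕ) : Prop where
  inj : ∀ i ≤ s, ∀ j ≤ s, p i = p j → i = j
  adj : ∀ i < s, A (p i) (p (i + 1))

/-- A path `p 0, …, p s` that starts in `z` and avoids `X`. -/
structure IsAvoidingPath (A : V → V → Prop) (X : Set V) (z : V) (p : ℕ → V) (s : ℕ) : Prop
    extends IsSeqPath A p s where
  start : p 0 = z
  avoid : ∀ i ≤ s, p i ∉ X

/-- A longest path from `z` that avoids `X`. -/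
def IsLongestPath (A : V → V → Prop) (X : Set V) (z : V) (p : ℕ → V) (s : ℕ) : Prop :=
  IsAvoidingPath A X z p s ∧ ∀ q t, IsAvoidingPath A X z q t → t ≤ s

theorem Nat.exists_max_of_bounded {P : ℕ → Prop} {n N : ℕ} (hn : P n) (hN : ∀ k, P k → k ≤ N) :
    ∃ k, P k ∧ ∀ l, P l → l ≤ k := by
  classical
  exact ⟨Nat.findGreatest P N, Nat.findGreatest_spec (hN n hn) hn,
    fun l hl => Nat.le_findGreatest (hN l hl) hl⟩

theorem IsSeqPath.lt_card [Fintype V] {p : ℕ → V} {s : ℕ} (hp : IsSeqPath A p s) :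
    s < Fintype.card V := by
  have h : Function.Injective fun i : Fin (s + 1) => p i := fun i j hij =>
    Fin.ext (hp.inj i (by omega) j (by omega) hij)
  have := Fintype.card_le_of_injective _ h
  rw [Fintype.card_fin] at this
  omega

theorem exists_isLongestPath [Fintype V] {X : Set V} {z : V} (hz : z ∉ X) :
    ∃ p s, IsLongestPath A X z p s := by
  have h0 : ∃ p, IsAvoidingPath A X z p 0 :=
    ⟨fun _ => z, ⟨⟨fun i hi j hj _ => by omega, fun i hi => by omega⟩, rfl, fun _ _ => hz⟩⟩
  obtain ⟨s, ⟨p, hp⟩, hs⟩ := Nat.exists_max_of_bounded (P := fun s => ∃ p, IsAvoidingPath A X z p s)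
    h0 (N := Fintype.card V) (fun k ⟨p, hp⟩ => hp.lt_card.le)
  exact ⟨p, s, hp, fun q t hq => hs t ⟨q, hq⟩⟩

/-- All neighbours of the last vertex of a longest path lie on the path or are forbidden. -/
theorem IsLongestPath.end_closed {X : Set V} {z : V} {p : ℕ → V} {s : ℕ}
    (hp : IsLongestPath A X z p s) {y : V} (hy : A (p s) y) (hX : y ∉ X) : ∃ m ≤ s, y = p m := by
  by_contra! hne
  obtain ⟨⟨⟨inj, adj⟩, start, avoid⟩, hmax⟩ := hp
  have := hmax (fun m => if m ≤ s then p m else y) (s + 1)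
    ⟨⟨fun i hi j hj hij => ?_, fun i hi => ?_⟩, by simpa using start, fun i hi => ?_⟩
  · omega
  · split_ifs at hij with h1 h2 h2
    · exact inj i h1 j h2 hij
    · exact absurd hij.symm (hne i h1)
    · exact absurd hij (hne j h2)
    · omega
  · rcases Nat.lt_or_ge i s with h | h
    · rw [if_pos h.le, if_pos (by omega)]; exact adj i h
    · obtain rfl : i = s := by omega
      rw [if_pos le_rfl, if_neg (by omega)]; exact hy
  · split_ifs with h
    · exact avoid i h
    · exact hX

/-- Rotating a longest path about a neighbour of its last vertex. -/
theorem IsLongestPath.rotate {X : Set V} {z : V} {p : ℕ → V} {s : ℕ}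
    (hA : ∀ a b, A a b → A b a) (hp : IsLongestPath A X z p s) {m : ℕ} (hm : m < s)
    (h : A (p m) (p s)) :
    ∃ q, IsLongestPath A X z q s ∧ q s = p (m + 1) ∧ ∀ k ≤ s, ∃ l ≤ s, q k = p l := by
  obtain ⟨⟨⟨inj, adj⟩, start, avoid⟩, hmax⟩ := hp
  -- The reflection `k ↦ s + m + 1 - k` reverses the tail after `m`. The length is unchanged, so
  -- maximality is inherited.
  refine ⟨fun k => p (if k ≤ m then k else s + m + 1 - k), ⟨⟨⟨fun i hi j hj hij => ?_,
    fun i hi => ?_⟩, by simpa using start, fun i hi => ?_⟩, hmax⟩, ?_, fun k hk => ?_⟩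
  · have := inj _ (by split_ifs <;> omega) _ (by split_ifs <;> omega) hij
    split_ifs at this <;> omega
  · rcases Nat.lt_trichotomy i m with hi' | rfl | hi'
    · rw [if_pos hi'.le, if_pos (by omega)]; exact adj i hi
    · rw [if_pos le_rfl, if_neg (by omega)]
      rwa [show s + i + 1 - (i + 1) = s by omega]
    · rw [if_neg (by omega), if_neg (by omega)]
      have := adj (s + m + 1 - (i + 1)) (by omega)
      rw [show s + m + 1 - (i + 1) + 1 = s + m + 1 - i by omega] at this
      exact hA _ _ this
  · exact avoid _ (by split_ifs <;> omega)
  · dsimp only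
    rw [if_neg (by omega)]; congr 1; omega
  · exact ⟨_, by split_ifs <;> omega, rfl⟩

theorem IsLongestPath.rotate_closed {X : Set V} {z : V} {p : ℕ → V} {s : ℕ}
    (hA : ∀ a b, A a b → A b a) (hp : IsLongestPath A X z p s) {m : ℕ} (hm : m < s)
    (h : A (p m) (p s)) {y : V} (hy : A (p (m + 1)) y) (hX : y ∉ X) : ∃ l ≤ s, y = p l := by
  obtain ⟨q, hq, hqs, hqp⟩ := hp.rotate hA hm h
  obtain ⟨k, hk, rfl⟩ := hq.end_closed (hqs ▸ hy) hX
  exact hqp k hk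

/-- A path such that rotating it about a neighbour of its last vertex always exposes a vertex all
of whose neighbours are on the path; `h` is the first index of a neighbour of the last vertex. -/
structure IsClosedPath (A : V → V → Prop) (p : ℕ → V) (s h : ℕ) : Prop
    extends IsSeqPath A p s where
  lt : h < s
  first_adj : A (p h) (p s)
  first : ∀ i < h, ¬ A (p i) (p s)
  closed : ∀ i < s, A (p i) (p s) → ∀ y, A (p (i + 1)) y → ∃ m ≤ s, y = p m

/-- A longest path with nothing forbidden works: connectivity and a second vertex give it positive
length, and its penultimate vertex is a neighbour of the last one. -/
theorem exists_isClosedPath [Fintype V] [Nontrivial V] (hA : ∀ a b, A a b → A b a)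
    (hconn : ∀ a b, Relation.ReflTransGen A a b) : ∃ p s h, IsClosedPath A p s h := by
  classical
  obtain ⟨a, b, hab⟩ := exists_pair_ne V
  obtain ⟨p, s, hp⟩ := exists_isLongestPath (A := A) (X := ∅) (z := a) (by simp)
  have hs : 0 < s := by
    by_contra hs
    obtain rfl : s = 0 := by omega
    have key : ∀ c, Relation.ReflTransGen A a c → c = a := by
      intro c hc
      induction hc with
      | refl => rfl
      | tail _ h ih =>
        subst ih
        obtain ⟨m, hm, rfl⟩ := hp.end_closed (hp.1.start.symm ▸ h) (by simp)
        obtain rfl : m = 0 := by omega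
        exact hp.1.start
    exact hab (key b (hconn a b)).symm
  have hex : ∃ i, A (p i) (p s) :=
    ⟨s - 1, by have := hp.1.adj (s - 1) (by omega); rwa [Nat.sub_add_cancel hs] at this⟩
  have hlt : Nat.find hex ≤ s - 1 := Nat.find_min' hex
    (by have := hp.1.adj (s - 1) (by omega); rwa [Nat.sub_add_cancel hs] at this)
  exact ⟨p, s, Nat.find hex, hp.1.toIsSeqPath, by omega, Nat.find_spec hex,
    fun i hi => Nat.find_min hex hi, fun i hi h y hy => hp.rotate_closed hA hi h hy (by simp)⟩

/-- If a path is left at `p i` towards a vertex `z` off the path, and longest paths from `z` off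
the path end at vertices without neighbours on the path, then there is a closed path whose
first index is larger than `i`. -/
theorem IsSeqPath.exists_isClosedPath_gt [Fintype V] (hA : ∀ a b, A a b → A b a)
    {p : ℕ → V} {s i : ℕ}
    (hp : IsSeqPath A p s) (hi : i ≤ s) {z : V} (hz : A (p i) z) {b : ℕ → V} {t : ℕ}
    (hb : IsLongestPath A {y | ∃ m ≤ s, y = p m} z b t)
    (hend : ∀ q, IsLongestPath A {y | ∃ m ≤ s, y = p m} z q t → ∀ m ≤ s, ¬ A (q t) (p m)) :
    ∃ q s' h, i < h ∧ IsClosedPath A q s' h := by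
  classical
  -- Otherwise the branch would end in `z`, which is adjacent to `p i`.
  have ht : 0 < t := by
    by_contra ht
    obtain rfl : t = 0 := by omega
    exact hend b hb i hi (hA _ _ (hb.1.start.symm ▸ hz))
  have hav : ∀ k ≤ t, ∀ m ≤ s, b k ≠ p m := fun k hk m hm h => hb.1.avoid k hk ⟨m, hm, h⟩
  -- The initial part of `p` up to `p i`, followed by the branch: `b m` has index `i + 1 + m`.
  set q : ℕ → V := fun m => if m ≤ i then p m else b (m - (i + 1)) with hq
  have hq1 : ∀ m ≤ i, q m = p m := fun m hm => if_pos hm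
  have hq2 : ∀ m, q (i + 1 + m) = b m := fun m => by
    simp only [hq]; rw [if_neg (by omega)]; congr 1; omega
  have hqt : q (i + 1 + t) = b t := hq2 t
  have hex : ∃ k, A (q k) (q (i + 1 + t)) := ⟨i + 1 + (t - 1), by
    rw [hq2, hq2]
    have := hb.1.adj (t - 1) (by omega)
    rwa [Nat.sub_add_cancel ht] at this⟩
  have hlow : ∀ k ≤ i, ¬ A (q k) (q (i + 1 + t)) := fun k hk h => by
    rw [hqt, hq1 k hk] at h
    exact hend b hb k (by omega) (hA _ _ h)
  have hfind : i < Nat.find hex := by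
    by_contra h
    exact hlow _ (by omega) (Nat.find_spec hex)
  refine ⟨q, i + 1 + t, Nat.find hex, hfind, ⟨fun j hj k hk hjk => ?_, fun j hj => ?_⟩, ?_,
    Nat.find_spec hex, fun k hk => Nat.find_min hex hk, fun j hj h y hy => ?_⟩
  · rcases Nat.lt_or_ge i j with h1 | h1 <;> rcases Nat.lt_or_ge i k with h2 | h2
    · obtain ⟨j, rfl⟩ := Nat.exists_eq_add_of_le (Nat.succ_le_of_lt h1)
      obtain ⟨k, rfl⟩ := Nat.exists_eq_add_of_le (Nat.succ_le_of_lt h2)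
      simp only [Nat.succ_eq_add_one, hq2] at hjk
      rw [hb.1.inj j (by omega) k (by omega) hjk]
    · obtain ⟨j, rfl⟩ := Nat.exists_eq_add_of_le (Nat.succ_le_of_lt h1)
      simp only [Nat.succ_eq_add_one, hq2, hq1 k h2] at hjk
      exact absurd hjk (hav j (by omega) k (by omega))
    · obtain ⟨k, rfl⟩ := Nat.exists_eq_add_of_le (Nat.succ_le_of_lt h2)
      simp only [Nat.succ_eq_add_one, hq2, hq1 j h1] at hjk
      exact absurd hjk.symm (hav k (by omega) j (by omega))
    · rw [hq1 j h1, hq1 k h2] at hjk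
      exact hp.inj j (by omega) k (by omega) hjk
  · rcases Nat.lt_trichotomy j i with h | rfl | h
    · rw [hq1 j h.le, hq1 _ h]; exact hp.adj j (by omega)
    · have := hq2 0
      rw [Nat.add_zero] at this
      rw [hq1 j le_rfl, this, hb.1.start]; exact hz
    · obtain ⟨j, rfl⟩ := Nat.exists_eq_add_of_le (Nat.succ_le_of_lt h)
      rw [Nat.succ_eq_add_one, Nat.add_assoc (i + 1) j 1, hq2, hq2]
      exact hb.1.adj j (by omega)
  · have : Nat.find hex ≤ i + 1 + (t - 1) := Nat.find_min' hex (by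
      rw [hq2, hq2]
      have := hb.1.adj (t - 1) (by omega)
      rwa [Nat.sub_add_cancel ht] at this)
    omega
  · have hij : i < j := by
      by_contra h'
      exact hlow j (by omega) h
    obtain ⟨j, rfl⟩ := Nat.exists_eq_add_of_le (Nat.succ_le_of_lt hij)
    rw [Nat.succ_eq_add_one, hq2, hq2] at h
    rw [Nat.succ_eq_add_one, Nat.add_assoc (i + 1) j 1, hq2] at hy
    -- The exposed vertex is the end of a rotated longest branch, so `hend` applies to it.
    have hyX : y ∉ {y | ∃ m ≤ s, y = p m} := by
      rintro ⟨m, hm, rfl⟩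
      obtain ⟨c, hc, hct, -⟩ := hb.rotate hA (by omega) h
      exact hend c hc m hm (hct ▸ hy)
    obtain ⟨l, hl, rfl⟩ := hb.rotate_closed hA (by omega) h hy hyX
    exact ⟨i + 1 + l, by omega, (hq2 l).symm⟩

/-- A closed path with the largest possible first index. -/
theorem exists_isClosedPath_max [Fintype V] [Nontrivial V] (hA : ∀ a b, A a b → A b a)
    (hconn : ∀ a b, Relation.ReflTransGen A a b) :
    ∃ p s h, IsClosedPath A p s h ∧ ∀ p' s' h', IsClosedPath A p' s' h' → h' ≤ h := by
  obtain ⟨p, s, h, hp⟩ := exists_isClosedPath hA hconn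
  obtain ⟨k, ⟨p', s', hk⟩, hmax⟩ := Nat.exists_max_of_bounded
    (P := fun h => ∃ p s, IsClosedPath A p s h) ⟨p, s, hp⟩ (N := Fintype.card V)
    (fun k ⟨p, s, hp⟩ => (hp.lt.trans hp.lt_card).le)
  exact ⟨p', s', k, hk, fun p s h hp => hmax h ⟨p, s, hp⟩⟩

end Paths

/-! ### Families of stars -/

section Stars

open Relation

variable {V : Type u} {J : Type v} (src : J → V) (snk : J → Set V)

/-- There is a star in `R` containing the arc from `a` to `b`. -/
def StarArc (R : Set J) (a b : V) : Prop := ∃ j ∈ R, src j = a ∧ b ∈ snk j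

/-- The star `j` crosses the cut `S`. -/
def StarCrosses (j : J) (S : Set V) : Prop := src j ∈ S ∧ ∃ b ∈ snk j, b ∉ S

/-- The stars `R` make `Q` strongly connected at a cost of one star for each vertex, and the cuts
`S₁` and `S₂` are crossed only by stars within `Q`, each of which crosses at most one of them. -/
structure IsStarEar (Q : Finset V) (R : Finset J) (S₁ S₂ : Set V) : Prop where
  one_lt_card : 1 < Q.card
  card_le : R.card ≤ Q.card
  conn : ∀ a ∈ Q, ∀ b ∈ Q, ReflTransGen (StarArc src snk (R : Set J)) a b
  cut₁ : S₁.Nonempty ∧ S₁ ≠ Set.univ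
  cut₂ : S₂.Nonempty ∧ S₂ ≠ Set.univ
  inside₁ : ∀ j, StarCrosses src snk j S₁ → src j ∈ Q ∧ snk j ⊆ Q
  inside₂ : ∀ j, StarCrosses src snk j S₂ → src j ∈ Q ∧ snk j ⊆ Q
  disjoint : ∀ j, StarCrosses src snk j S₁ → ¬ StarCrosses src snk j S₂

variable {src snk}

theorem StarArc.mono {R R' : Set J} (h : R ⊆ R') {a b : V}
    (hab : ReflTransGen (StarArc src snk R) a b) : ReflTransGen (StarArc src snk R') a b :=
  hab.lift id fun _ _ ⟨j, hj, h'⟩ => ⟨j, h hj, h'⟩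

theorem exists_starCrosses {R : Set J} {S : Set V} {a b : V}
    (hab : ReflTransGen (StarArc src snk R) a b) (ha : a ∈ S) (hb : b ∉ S) :
    ∃ j ∈ R, StarCrosses src snk j S := by
  induction hab with
  | refl => exact absurd ha hb
  | @tail c d _ hcd ih =>
    by_cases hc : c ∈ S
    · obtain ⟨j, hj, rfl, hd⟩ := hcd
      exact ⟨j, hj, hc, d, hd, hb⟩
    · exact ih hc

theorem singleton_cut {u w : V} (huw : u ≠ w) :
    ({u} : Set V).Nonempty ∧ ({u} : Set V) ≠ Set.univ :=
  ⟨Set.singleton_nonempty u, fun h => huw.symm (by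
    have : w ∈ ({u} : Set V) := h ▸ Set.mem_univ w
    simpa using this)⟩

/-- A star crossing a singleton has its source there, so it cannot cross two different singletons.
-/
theorem IsStarEar.of_two_vertices {Q : Finset V} {R : Finset J} {u w : V} (huw : u ≠ w)
    (hu : u ∈ Q) (hw : w ∈ Q) (hR : R.card ≤ Q.card)
    (hconn : ∀ a ∈ Q, ∀ b ∈ Q, ReflTransGen (StarArc src snk (R : Set J)) a b)
    (hu' : ∀ y, StarArc src snk Set.univ u y → y ∈ Q)
    (hw' : ∀ y, StarArc src snk Set.univ w y → y ∈ Q) :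
    IsStarEar src snk Q R {u} {w} where
  one_lt_card := Finset.one_lt_card.2 ⟨u, hu, w, hw, huw⟩
  card_le := hR
  conn := hconn
  cut₁ := singleton_cut huw
  cut₂ := singleton_cut huw.symm
  inside₁ := by
    rintro j ⟨h, -⟩
    obtain rfl : src j = u := h
    exact ⟨hu, fun y hy => hu' y ⟨j, trivial, rfl, hy⟩⟩
  inside₂ := by
    rintro j ⟨h, -⟩
    obtain rfl : src j = w := h
    exact ⟨hw, fun y hy => hw' y ⟨j, trivial, rfl, hy⟩⟩
  disjoint := by
    rintro j ⟨h, -⟩ ⟨h', -⟩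
    exact huw ((show src j = u from h).symm.trans h')

/-- The cut `{u}` is crossed by stars leaving `u`, its complement by stars entering `u`; no star
does both. -/
theorem IsStarEar.of_compl {Q : Finset V} {R : Finset J} {u w : V} (huw : u ≠ w)
    (hu : u ∈ Q) (hw : w ∈ Q) (hR : R.card ≤ Q.card)
    (hconn : ∀ a ∈ Q, ∀ b ∈ Q, ReflTransGen (StarArc src snk (R : Set J)) a b)
    (hu' : ∀ y, StarArc src snk Set.univ u y → y ∈ Q)
    (hin : ∀ j, src j ≠ u → u ∈ snk j → src j ∈ Q ∧ snk j ⊆ Q) :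
    IsStarEar src snk Q R {u} {u}ᶜ where
  one_lt_card := Finset.one_lt_card.2 ⟨u, hu, w, hw, huw⟩
  card_le := hR
  conn := hconn
  cut₁ := singleton_cut huw
  cut₂ := ⟨⟨w, huw.symm⟩, fun h => (h ▸ Set.mem_univ u : u ∈ ({u} : Set V)ᶜ) rfl⟩
  inside₁ := by
    rintro j ⟨h, -⟩
    obtain rfl : src j = u := h
    exact ⟨hu, fun y hy => hu' y ⟨j, trivial, rfl, hy⟩⟩
  inside₂ := by
    rintro j ⟨h, y, hy, hyu⟩
    obtain rfl : y = u := by simpa using hyu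
    exact hin j h hy
  disjoint := fun j h h' => h'.1 h.1

/-- Traversing a path whose vertex `p i` has a star containing the last vertex: forwards up to
`p i`, then from the last vertex back to `p (i + 1)`, and from there to `p t`. -/
theorem IsSeqPath.exists_rotated_stars {p : ℕ → V} {s i t lo : ℕ}
    (hA : ∀ a b, StarArc src snk Set.univ a b → StarArc src snk Set.univ b a)
    (hp : IsSeqPath (StarArc src snk Set.univ) p s) (hi : i < s) (hlo : lo ≤ i) {j₀ : J}
    (hsrc : src j₀ = p i) (hsnk : p s ∈ snk j₀)
    (ht : StarArc src snk Set.univ (p (i + 1)) (p t)) :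
    ∃ R : Finset J, R.card ≤ s + 1 - lo ∧ j₀ ∈ R ∧
      (∀ m, lo ≤ m → m ≤ i → ReflTransGen (StarArc src snk (R : Set J)) (p lo) (p m) ∧
        ReflTransGen (StarArc src snk (R : Set J)) (p m) (p i)) ∧
      ∀ m, i < m → m ≤ s → ReflTransGen (StarArc src snk (R : Set J)) (p i) (p m) ∧
        ReflTransGen (StarArc src snk (R : Set J)) (p m) (p t) := by
  classical
  -- One star per index: forward arcs below `i`, `j₀` at `i`, the arc to `p t` at `i + 1`, backward
  -- arcs above. Beyond `s` the value `j₀` is a dummy.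
  have hex : ∀ m, ∃ j, m ≤ s → src j = p m ∧ (m = i → j = j₀) ∧ (m < i → p (m + 1) ∈ snk j) ∧
      (m = i + 1 → p t ∈ snk j) ∧ (i + 1 < m → p (m - 1) ∈ snk j) := by
    intro m
    by_cases hms : m ≤ s
    swap
    · exact ⟨j₀, fun h => absurd h hms⟩
    rcases Nat.lt_trichotomy m i with h | rfl | h
    · obtain ⟨j, -, h1, h2⟩ := hp.adj m (by omega)
      exact ⟨j, fun _ => ⟨h1, by omega, fun _ => h2, by omega, by omega⟩⟩
    · exact ⟨j₀, fun _ => ⟨hsrc, fun _ => rfl, by omega, by omega, by omega⟩⟩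
    · rcases Nat.eq_or_lt_of_le (Nat.succ_le_of_lt h) with rfl | h'
      · obtain ⟨j, -, h1, h2⟩ := ht
        exact ⟨j, fun _ => ⟨h1, by omega, by omega, fun _ => h2, by omega⟩⟩
      · have := hp.adj (m - 1) (by omega)
        rw [Nat.sub_add_cancel (by omega)] at this
        obtain ⟨j, -, h1, h2⟩ := hA _ _ this
        exact ⟨j, fun _ => ⟨h1, by omega, by omega, by omega, fun _ => h2⟩⟩
  choose f hf using hex
  have hmem : ∀ m, lo ≤ m → m ≤ s → f m ∈ (((Finset.Icc lo s).image f : Finset J) : Set J) :=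
    fun m h1 h2 => Finset.mem_coe.2 (Finset.mem_image_of_mem f (Finset.mem_Icc.2 ⟨h1, h2⟩))
  have hfi : f i = j₀ := (hf i hi.le).2.1 rfl
  refine ⟨(Finset.Icc lo s).image f, Finset.card_image_le.trans (by simp),
    Finset.mem_coe.1 (hfi ▸ hmem i hlo hi.le), fun m h1 h2 => ⟨?_, ?_⟩, fun m h1 h2 => ⟨?_, ?_⟩⟩
  · induction m, h1 using Nat.le_induction with
    | base => exact .refl
    | succ m h1 ih =>
      exact (ih (by omega)).tail ⟨f m, hmem m h1 (by omega), (hf m (by omega)).1,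
        (hf m (by omega)).2.2.1 (by omega)⟩
  · induction h2 using Nat.decreasingInduction with
    | self => exact .refl
    | of_succ m h2 ih =>
      exact (ih (by omega)).head ⟨f m, hmem m h1 (by omega), (hf m (by omega)).1,
        (hf m (by omega)).2.2.1 (by omega)⟩
  · have h0 : ReflTransGen (StarArc src snk (((Finset.Icc lo s).image f : Finset J) : Set J))
        (p i) (p s) := .single ⟨f i, hmem i hlo hi.le, (hf i hi.le).1, hfi.symm ▸ hsnk⟩
    induction h2 using Nat.decreasingInduction with
    | self => exact h0
    | of_succ m h2 ih =>
      exact (ih (by omega)).tail ⟨f (m + 1), hmem _ (by omega) (by omega),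
        (hf (m + 1) (by omega)).1, (hf (m + 1) (by omega)).2.2.2.2 (by omega)⟩
  · induction m, h1 using Nat.le_induction with
    | base =>
      exact .single ⟨f (i + 1), hmem _ (by omega) (by omega), (hf (i + 1) (by omega)).1,
        (hf (i + 1) (by omega)).2.2.2.1 rfl⟩
    | succ m h1 ih =>
      exact (ih (by omega)).head ⟨f (m + 1), hmem _ (by omega) (by omega),
        (hf (m + 1) (by omega)).1, (hf (m + 1) (by omega)).2.2.2.2 (by omega)⟩

theorem IsSeqPath.card_image_Icc [DecidableEq V] {A : V → V → Prop} {p : ℕ → V} {s : ℕ}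
    (hp : IsSeqPath A p s) (lo : ℕ) : ((Finset.Icc lo s).image p).card = s + 1 - lo := by
  rw [Finset.card_image_of_injOn, Nat.card_Icc]
  intro a ha b hb hab
  simp only [Finset.coe_Icc, Set.mem_Icc] at ha hb
  exact hp.inj a ha.2 b hb.2 hab

/-- A segment `p lo, …, p s` of a path is made strongly connected by one star for each vertex if
the star `j₀` of `p i` contains the last vertex, `p (i + 1)` is adjacent to `p t`, and `lo` is
either `t` or reached by `j₀`. -/
theorem IsSeqPath.exists_segment_stars [DecidableEq V] {p : ℕ → V} {s i t lo : ℕ}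
    (hA : ∀ a b, StarArc src snk Set.univ a b → StarArc src snk Set.univ b a)
    (hp : IsSeqPath (StarArc src snk Set.univ) p s) (hi : i < s) (hti : t ≤ i) {j₀ : J}
    (hsrc : src j₀ = p i) (hsnk : p s ∈ snk j₀)
    (ht : StarArc src snk Set.univ (p (i + 1)) (p t)) (hlt : lo ≤ t)
    (hlo : lo = t ∨ p lo ∈ snk j₀) :
    ∃ R : Finset J, R.card ≤ ((Finset.Icc lo s).image p).card ∧
      ∀ a ∈ (Finset.Icc lo s).image p, ∀ b ∈ (Finset.Icc lo s).image p,
        ReflTransGen (StarArc src snk (R : Set J)) a b := by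
  obtain ⟨R, hR, hj, h1, h2⟩ := hp.exists_rotated_stars hA hi (hlt.trans hti) hsrc hsnk ht
  refine ⟨R, by rwa [hp.card_image_Icc], fun a ha b hb => ?_⟩
  -- If `lo = t`, the way back is through `p s` and then `p (i + 1)`; otherwise `j₀` has an arc to
  -- `p lo`.
  have hlo' : ReflTransGen (StarArc src snk (R : Set J)) (p i) (p lo) := by
    rcases hlo with rfl | hlo
    · exact (h2 (i + 1) (by omega) (by omega)).1.trans (h2 (i + 1) (by omega) (by omega)).2
    · exact .single ⟨j₀, hj, hsrc, hlo⟩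
  simp only [Finset.mem_image, Finset.mem_Icc] at ha hb
  obtain ⟨m, hm, rfl⟩ := ha
  obtain ⟨k, hk, rfl⟩ := hb
  trans p i
  · rcases Nat.lt_or_ge i m with h | h
    · exact (h2 m h hm.2).2.trans (h1 t hlt hti).2
    · exact (h1 m hm.1 h).2
  · rcases Nat.lt_or_ge i k with h | h
    · exact (h2 k h hk.2).1
    · exact hlo'.trans (h1 k hk.1 h).1

/-- The least index of a neighbour, on a path, of a vertex adjacent to the path. -/
theorem exists_first_adj {A : V → V → Prop} {p : ℕ → V} {a : V} {k : ℕ} (hk : A a (p k)) :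
    ∃ t ≤ k, A a (p t) ∧ ∀ m, A a (p m) → t ≤ m := by
  classical
  have hex : ∃ t, A a (p t) := ⟨k, hk⟩
  exact ⟨Nat.find hex, Nat.find_min' hex hk, Nat.find_spec hex, fun m hm => Nat.find_min' hex hm⟩

/-- The single star `j₀` enters both the rotated tail (at `p s`) and the branch (at `z`), and both
return to the path, so one star per vertex suffices. The exposed vertices `p (i + 1)` and `b t` give
the cuts. -/
theorem IsClosedPath.exists_ear_of_branch [DecidableEq V] {p : ℕ → V} {s h i : ℕ}
    (hA : ∀ a b, StarArc src snk Set.univ a b → StarArc src snk Set.univ b a)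
    (hp : IsClosedPath (StarArc src snk Set.univ) p s h) (hi : i < s) {j₀ : J}
    (hsrc : src j₀ = p i) (hsnk : p s ∈ snk j₀) {z : V} (hz : z ∈ snk j₀) {b : ℕ → V} {t k : ℕ}
    (hb : IsLongestPath (StarArc src snk Set.univ) {y | ∃ m ≤ s, y = p m} z b t) (hk : k ≤ s)
    (hbk : StarArc src snk Set.univ (b t) (p k)) :
    ∃ Q R S₁ S₂, IsStarEar src snk Q R S₁ S₂ := by
  have hadj : StarArc src snk Set.univ (p i) (p s) := ⟨j₀, trivial, hsrc, hsnk⟩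
  obtain ⟨c, hck, hbc, hcmin⟩ := exists_first_adj hbk
  obtain ⟨d, hdi, hd, hdmin⟩ := exists_first_adj (hA _ _ (hp.adj i hi))
  have hav : ∀ k ≤ t, ∀ m ≤ s, b k ≠ p m := fun k hk m hm h => hb.1.avoid k hk ⟨m, hm, h⟩
  obtain ⟨R, hR, hj, h1, h2⟩ := hp.toIsSeqPath.exists_rotated_stars hA hi
    ((min_le_right c d).trans hdi) hsrc hsnk hd
  -- `c` and `d` are the lowest neighbours on the path of `b t` and `p (i + 1)`; starting at their
  -- minimum puts all these neighbours into `Q`.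
  set lo := min c d with hlo
  have hex : ∀ m, ∃ j, m ≤ t → src j = b m ∧ (m < t → b (m + 1) ∈ snk j) ∧
      (m = t → p c ∈ snk j) := by
    intro m
    rcases Nat.lt_trichotomy m t with hm | rfl | hm
    · obtain ⟨j, -, h1, h2⟩ := hb.1.adj m hm
      exact ⟨j, fun _ => ⟨h1, fun _ => h2, by omega⟩⟩
    · obtain ⟨j, -, h1, h2⟩ := hbc
      exact ⟨j, fun _ => ⟨h1, by omega, fun _ => h2⟩⟩
    · exact ⟨j₀, by omega⟩
  choose g hg using hex
  classical
  set R' := R ∪ (Finset.range (t + 1)).image g with hR'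
  set Q := (Finset.Icc lo s).image p ∪ (Finset.range (t + 1)).image b with hQ
  have hgmem : ∀ m ≤ t, g m ∈ (R' : Set J) := fun m hm => by
    rw [hR', Finset.mem_coe, Finset.mem_union]
    exact Or.inr (Finset.mem_image_of_mem g (Finset.mem_range.2 (by omega)))
  have hmono : ∀ {x y}, ReflTransGen (StarArc src snk (R : Set J)) x y →
      ReflTransGen (StarArc src snk (R' : Set J)) x y := fun h =>
    StarArc.mono (by rw [hR', Finset.coe_union]; exact Set.subset_union_left) h
  have hpQ : ∀ m, lo ≤ m → m ≤ s → p m ∈ Q := fun m hm hm' =>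
    Finset.mem_union_left _ (Finset.mem_image_of_mem p (Finset.mem_Icc.2 ⟨hm, hm'⟩))
  have hbQ : ∀ m ≤ t, b m ∈ Q := fun m hm =>
    Finset.mem_union_right _ (Finset.mem_image_of_mem b (Finset.mem_range.2 (by omega)))
  have hQcard : Q.card = (s + 1 - lo) + (t + 1) := by
    rw [hQ, Finset.card_union_of_disjoint, hp.toIsSeqPath.card_image_Icc,
      Finset.card_image_of_injOn, Finset.card_range]
    · intro a ha b hb' hab
      simp only [Finset.coe_range, Set.mem_Iio] at ha hb'
      exact hb.1.inj a (by omega) b (by omega) hab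
    · rw [Finset.disjoint_left]
      intro a ha ha'
      simp only [Finset.mem_image, Finset.mem_Icc, Finset.mem_range] at ha ha'
      obtain ⟨m, hm, rfl⟩ := ha
      obtain ⟨k, hk, hkm⟩ := ha'
      exact hav k (by omega) m hm.2 hkm
  have hR'card : R'.card ≤ Q.card := by
    rw [hQcard]
    refine (Finset.card_union_le _ _).trans (Nat.add_le_add hR ?_)
    exact Finset.card_image_le.trans (by simp)
  have hb0 : ∀ m ≤ t, ReflTransGen (StarArc src snk (R' : Set J)) (p i) (b m) := by
    intro m
    induction m with
    | zero =>
      intro _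
      refine .single ⟨j₀, ?_, hsrc, hb.1.start.symm ▸ hz⟩
      rw [hR', Finset.mem_coe]
      exact Finset.mem_union_left _ hj
    | succ m ih =>
      intro hm
      exact (ih (by omega)).tail ⟨g m, hgmem m (by omega), (hg m (by omega)).1,
        (hg m (by omega)).2.1 (by omega)⟩
  have hbt : ∀ m ≤ t, ReflTransGen (StarArc src snk (R' : Set J)) (b m) (p c) := by
    intro m hm
    induction hm using Nat.decreasingInduction with
    | self => exact .single ⟨g t, hgmem t le_rfl, (hg t le_rfl).1, (hg t le_rfl).2.2 rfl⟩
    | of_succ m hm ih =>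
      exact ih.head ⟨g m, hgmem m (by omega), (hg m (by omega)).1,
        (hg m (by omega)).2.1 (by omega)⟩
  have hto : ∀ m, lo ≤ m → m ≤ s → ReflTransGen (StarArc src snk (R' : Set J)) (p m) (p i) := by
    intro m hm hms
    rcases Nat.lt_or_ge i m with h | h
    · exact (hmono (h2 m h hms).2).trans (hmono (h1 d (min_le_right c d) hdi).2)
    · exact hmono (h1 m hm h).2
  have hlo' : ReflTransGen (StarArc src snk (R' : Set J)) (p i) (p lo) := by
    rcases min_choice c d with h | h
    · rw [hlo, h]
      exact (hb0 t le_rfl).trans (hbt t le_rfl)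
    · rw [hlo, h]
      exact (hmono (h2 (i + 1) (by omega) (by omega)).1).trans
        (hmono (h2 (i + 1) (by omega) (by omega)).2)
  have hhub : ∀ a ∈ Q, ReflTransGen (StarArc src snk (R' : Set J)) a (p i) ∧
      ReflTransGen (StarArc src snk (R' : Set J)) (p i) a := by
    intro a ha
    simp only [hQ, Finset.mem_union, Finset.mem_image, Finset.mem_Icc, Finset.mem_range] at ha
    rcases ha with ⟨m, hm, rfl⟩ | ⟨m, hm, rfl⟩
    · refine ⟨hto m hm.1 hm.2, ?_⟩
      rcases Nat.lt_or_ge i m with h | h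
      · exact hmono (h2 m h hm.2).1
      · exact hlo'.trans (hmono (h1 m hm.1 h).1)
    · exact ⟨(hbt m (by omega)).trans (hto c (min_le_left c d) (hck.trans hk)), hb0 m (by omega)⟩
  refine ⟨Q, R', {p (i + 1)}, {b t}, .of_two_vertices (hav t le_rfl (i + 1) hi).symm
    (hpQ (i + 1) ((min_le_right c d).trans (by omega)) hi) (hbQ t le_rfl) hR'card
    (fun a ha b hb => (hhub a ha).1.trans (hhub b hb).2) (fun y hy => ?_) fun y hy => ?_⟩
  · obtain ⟨m, hm, rfl⟩ := hp.closed i hi hadj y hy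
    exact hpQ m ((min_le_right c d).trans (hdmin m hy)) hm
  · by_cases hyP : y ∈ {y | ∃ m ≤ s, y = p m}
    · obtain ⟨m, hm, rfl⟩ := hyP
      exact hpQ m ((min_le_left c d).trans (hcmin m hy)) hm
    · obtain ⟨m, hm, rfl⟩ := hb.end_closed hy hyP
      exact hbQ m hm

/-- Every bidirected, strongly connected family of stars on at least two vertices has an ear. -/
theorem exists_isStarEar [Fintype V] [Nontrivial V]
    (hA : ∀ a b, StarArc src snk Set.univ a b → StarArc src snk Set.univ b a)
    (hconn : ∀ a b, ReflTransGen (StarArc src snk Set.univ) a b) :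
    ∃ Q R S₁ S₂, IsStarEar src snk Q R S₁ S₂ := by
  classical
  obtain ⟨p, s, h, hp, hmax⟩ := exists_isClosedPath_max hA hconn
  have hs : s - 1 + 1 = s := Nat.sub_add_cancel (by have := hp.lt; omega)
  have hs1 : s - 1 < s := by omega
  have hpred : StarArc src snk Set.univ (p (s - 1)) (p s) := by
    have := hp.adj (s - 1) hs1
    rwa [hs] at this
  have hend : ∀ y, StarArc src snk Set.univ (p s) y → ∃ m ≤ s, y = p m := fun y hy =>
    hp.closed (s - 1) hs1 hpred y (hs.symm ▸ hy)
  have hfirst : ∀ m, StarArc src snk Set.univ (p s) (p m) → h ≤ m := fun m hm => by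
    by_contra hlt
    exact hp.first m (by omega) (hA _ _ hm)
  -- First case: a star containing an arc from the path to its last vertex also leaves the path.
  by_cases hB : ∃ j, ∃ i < s, src j = p i ∧ p s ∈ snk j ∧ ∃ z ∈ snk j, ∀ m ≤ s, z ≠ p m
  · obtain ⟨j, i, hi, hsrc, hsnk, z, hz, hzP⟩ := hB
    have hzX : z ∉ {y | ∃ m ≤ s, y = p m} := fun ⟨m, hm, hzm⟩ => hzP m hm hzm
    by_cases hC : ∃ b t, IsLongestPath (StarArc src snk Set.univ) {y | ∃ m ≤ s, y = p m} z b t ∧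
        ∃ k ≤ s, StarArc src snk Set.univ (b t) (p k)
    · obtain ⟨b, t, hb, k, hk, hbk⟩ := hC
      exact hp.exists_ear_of_branch hA hi hsrc hsnk hz hb hk hbk
    -- No longest branch returns to the path: following one gives a closed path with first index
    -- greater than `i ≥ h`, against maximality.
    · obtain ⟨b, t, hb⟩ := exists_isLongestPath (A := StarArc src snk Set.univ) hzX
      obtain ⟨q, s', h', hih, hq⟩ := hp.toIsSeqPath.exists_isClosedPath_gt hA hi.le
        ⟨j, trivial, hsrc, hz⟩ hb fun q hq m hm hqm => hC ⟨q, t, hq, m, hm, hqm⟩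
      have := hmax q s' h' hq
      have := hfirst i (hA _ _ ⟨j, trivial, hsrc, hsnk⟩)
      omega
  push Not at hB
  -- Second case: such a star reaches below `h`. Its arc to `p k` closes the segment; `i + 1 < s`
  -- keeps the two singleton cuts distinct.
  by_cases hC : ∃ j, ∃ i, i + 1 < s ∧ src j = p i ∧ p s ∈ snk j ∧ ∃ k < h, p k ∈ snk j
  · obtain ⟨j, i, hi, hsrc, hsnk, k, hk, hkj⟩ := hC
    have hadj : StarArc src snk Set.univ (p i) (p s) := ⟨j, trivial, hsrc, hsnk⟩
    obtain ⟨t, hti, ht, htmin⟩ := exists_first_adj (hA _ _ (hp.adj i (by omega)))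
    obtain ⟨R, hR, hRconn⟩ := hp.toIsSeqPath.exists_segment_stars hA (by omega) hti hsrc hsnk ht
      (min_le_right k t) (by
        rcases min_choice k t with h | h <;> rw [h]
        · exact Or.inr hkj
        · exact Or.inl rfl)
    have hmem : ∀ m, min k t ≤ m → m ≤ s → p m ∈ (Finset.Icc (min k t) s).image p :=
      fun m hm hm' => Finset.mem_image_of_mem p (Finset.mem_Icc.2 ⟨hm, hm'⟩)
    refine ⟨_, R, {p s}, {p (i + 1)}, .of_two_vertices (fun h => ?_) (hmem s (by omega) le_rfl)
      (hmem (i + 1) (by omega) hi.le) hR hRconn (fun y hy => ?_) fun y hy => ?_⟩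
    · have := hp.inj s le_rfl (i + 1) hi.le h
      omega
    · obtain ⟨m, hm, rfl⟩ := hend y hy
      have := hfirst m hy
      exact hmem m (by omega) hm
    · obtain ⟨m, hm, rfl⟩ := hp.closed i (by omega) hadj y hy
      have := htmin m hy
      exact hmem m (by omega) hm
  push Not at hC
  -- Now only stars of `p (s - 1)` can contain `p s` and reach below `h`. Taking `lo` lowest among
  -- `h` and the vertices they reach puts every star that contains `p s` inside the segment, so the
  -- complement of `{p s}` can be the second cut.
  obtain ⟨lo, j, hsrc, hsnk, hloh, hlo, hlomin⟩ : ∃ lo j, src j = p (s - 1) ∧ p s ∈ snk j ∧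
      lo ≤ h ∧ (lo = h ∨ p lo ∈ snk j) ∧
      ∀ j', src j' = p (s - 1) → p s ∈ snk j' → ∀ m, p m ∈ snk j' → lo ≤ m := by
    by_cases hex : ∃ m, ∃ j, src j = p (s - 1) ∧ p s ∈ snk j ∧ p m ∈ snk j ∧ m < h
    · obtain ⟨j, h1, h2, h3, h4⟩ := Nat.find_spec hex
      refine ⟨Nat.find hex, j, h1, h2, h4.le, Or.inr h3, fun j' h1' h2' m hm => ?_⟩
      by_contra hlt
      exact Nat.find_min hex (by omega) ⟨j', h1', h2', hm, by omega⟩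
    · push Not at hex
      obtain ⟨j, -, h1, h2⟩ := hpred
      exact ⟨h, j, h1, h2, le_rfl, Or.inl rfl, fun j' h1' h2' m hm => hex m j' h1' h2' hm⟩
  have hhs := hp.lt
  obtain ⟨R, hR, hRconn⟩ := hp.toIsSeqPath.exists_segment_stars hA hs1 (t := h) (by omega) hsrc
    hsnk (by rw [hs]; exact hA _ _ hp.first_adj) hloh hlo
  have hmem : ∀ m, lo ≤ m → m ≤ s → p m ∈ (Finset.Icc lo s).image p :=
    fun m hm hm' => Finset.mem_image_of_mem p (Finset.mem_Icc.2 ⟨hm, hm'⟩)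
  refine ⟨_, R, {p s}, {p s}ᶜ, .of_compl (w := p (s - 1)) (fun h => ?_) (hmem s (by omega) le_rfl)
    (hmem (s - 1) (by omega) hs1.le) hR hRconn (fun y hy => ?_) fun j' hj' hj's => ?_⟩
  · have := hp.inj s le_rfl (s - 1) hs1.le h
    omega
  · obtain ⟨m, hm, rfl⟩ := hend y hy
    have := hfirst m hy
    exact hmem m (by omega) hm
  · have hadj : StarArc src snk Set.univ (p s) (src j') := hA _ _ ⟨j', trivial, rfl, hj's⟩
    obtain ⟨i, hi, hji⟩ := hend _ hadj
    have hi' : i < s := lt_of_le_of_ne hi fun h => hj' (h ▸ hji)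
    have hhi : h ≤ i := hfirst i (hji ▸ hadj)
    refine ⟨hji ▸ hmem i (by omega) hi, fun y hy => ?_⟩
    have hyP : ∃ m ≤ s, y = p m := by
      by_contra! hne
      obtain ⟨m, hm, h⟩ := hB j' i hi' hji hj's y hy
      exact hne m hm h
    obtain ⟨m, hm, rfl⟩ := hyP
    refine Finset.mem_coe.2 (hmem m ?_ hm)
    rcases Nat.lt_or_ge (i + 1) s with h1 | h1
    · by_contra hlt
      exact hC j' i h1 hji hj's m (by omega) hy
    · obtain rfl : i = s - 1 := by omega
      exact hlomin j' hji hj's m hy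

end Stars

/-! ### Contraction -/

section Contraction

open Relation

variable {V : Type u} {J : Type v}

/-- Contracting a nonempty set of vertices to one vertex. -/
theorem Finset.exists_contraction [Fintype V] {Q : Finset V} (hQ : Q.Nonempty) :
    ∃ (W : Type u) (_ : Fintype W) (π : V → W), Function.Surjective π ∧
      (∀ a b, π a = π b ↔ a = b ∨ a ∈ Q ∧ b ∈ Q) ∧
      Fintype.card W + Q.card = Fintype.card V + 1 := by
  classical
  obtain ⟨q, hq⟩ := hQ
  -- The vertex `q` represents the contracted set.
  refine ⟨{v // v ∈ insert q Qᶜ}, inferInstance,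
    fun v => if h : v ∈ Q then ⟨q, by simp⟩ else ⟨v, by simp [h]⟩, ?_, fun a b => ?_, ?_⟩
  · rintro ⟨v, hv⟩
    refine ⟨v, ?_⟩
    by_cases h : v ∈ Q
    · obtain rfl : v = q := by simpa [h] using hv
      simp [h]
    · simp [h]
  · by_cases ha : a ∈ Q <;> by_cases hb : b ∈ Q <;> simp only [ha, hb, dite_true, dite_false]
    · simp
    · simp only [Subtype.mk.injEq, and_false, or_false]
      exact ⟨fun h => absurd (h ▸ hq) hb, fun h => absurd (h ▸ ha) hb⟩
    · simp only [Subtype.mk.injEq, false_and, or_false]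
      exact ⟨fun h => absurd (h ▸ hq) ha, fun h => absurd (h ▸ hb) ha⟩
    · simp
  · rw [Fintype.card_coe, Finset.card_insert_of_notMem (by simpa using hq)]
    have := Finset.card_add_card_compl Q
    omega

variable {src : J → V} {snk : J → Set V}

theorem StarArc.image {W : Type w} (π : V → W) {R : Set J} {a b : V}
    (h : StarArc src snk R a b) : StarArc (π ∘ src) (fun j => π '' snk j) R (π a) (π b) := by
  obtain ⟨j, hj, rfl, hb⟩ := h
  exact ⟨j, hj, rfl, b, hb, rfl⟩

theorem starCrosses_preimage {W : Type w} (π : V → W) {j : J} {S : Set W} :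
    StarCrosses src snk j (π ⁻¹' S) ↔ StarCrosses (π ∘ src) (fun j => π '' snk j) j S := by
  simp [StarCrosses]

/-- A strongly connected choice of stars in a contraction lifts if fibres are connected. -/
theorem StarArc.reflTransGen_of_image {W : Type w} {π : V → W} {R R' : Set J} (hR : R ⊆ R')
    (hfib : ∀ a b, π a = π b → ReflTransGen (StarArc src snk R') a b) {x y : W}
    (h : ReflTransGen (StarArc (π ∘ src) (fun j => π '' snk j) R) x y) :
    ∀ a b, π a = x → π b = y → ReflTransGen (StarArc src snk R') a b := by
  induction h with
  | refl => exact fun a b ha hb => hfib a b (ha.trans hb.symm)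
  | tail _ hyz ih =>
    rintro a b ha rfl
    obtain ⟨j, hj, rfl, c, hc, hcb⟩ := hyz
    exact ((ih a (src j) ha rfl).tail ⟨j, hR hj, rfl, hc⟩).trans (hfib c b hcb)

/-- A strongly connected family `R` of stars and a family `𝒮` of cuts, no two of which are crossed
by the same star. -/
structure IsStarCutPair (src : J → V) (snk : J → Set V) (R : Finset J) (𝒮 : Finset (Set V)) :
    Prop where
  conn : ∀ a b, ReflTransGen (StarArc src snk (R : Set J)) a b
  cut : ∀ S ∈ 𝒮, S.Nonempty ∧ S ≠ Set.univ
  disjoint : ∀ j, ∀ S ∈ 𝒮, ∀ T ∈ 𝒮, StarCrosses src snk j S → StarCrosses src snk j T → S = T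

/-- Preimages of cuts do not separate vertices of `Q`, so stars inside `Q` cross none of them; these
are the only stars crossing `S₁` or `S₂`. -/
theorem IsStarEar.uncontract [DecidableEq J] {Q : Finset V} {R₀ : Finset J} {S₁ S₂ : Set V}
    (hconn : ∀ a b, ReflTransGen (StarArc src snk Set.univ) a b)
    (he : IsStarEar src snk Q R₀ S₁ S₂) {W : Type u} {π : V → W} (hπ : Function.Surjective π)
    (hfib : ∀ a b, π a = π b ↔ a = b ∨ a ∈ Q ∧ b ∈ Q) {R : Finset J} {𝒮 : Finset (Set W)}
    (h : IsStarCutPair (π ∘ src) (fun j => π '' snk j) R 𝒮) :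
    ∃ 𝒯 : Finset (Set V), 𝒯.card = 𝒮.card + 2 ∧ IsStarCutPair src snk (R ∪ R₀) 𝒯 := by
  classical
  have hout : ∀ S ∈ 𝒮.image (π ⁻¹' ·), ∀ j, src j ∈ Q ∧ snk j ⊆ Q → ¬ StarCrosses src snk j S := by
    intro S hS j ⟨hj, hjQ⟩ ⟨h1, b, hb, h2⟩
    obtain ⟨S', -, rfl⟩ := Finset.mem_image.1 hS
    have : π (src j) = π b := (hfib _ _).2 (Or.inr ⟨hj, hjQ hb⟩)
    exact h2 (by simpa [this] using h1)
  have hcross : ∀ S : Set V, S.Nonempty ∧ S ≠ Set.univ → ∃ j, StarCrosses src snk j S := by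
    rintro S ⟨⟨a, ha⟩, hS⟩
    obtain ⟨b, hb⟩ := (Set.ne_univ_iff_exists_notMem S).1 hS
    obtain ⟨j, -, hj⟩ := exists_starCrosses (hconn a b) ha hb
    exact ⟨j, hj⟩
  -- Every cut is crossed by some star, so the disjointness of crossing stars forces the new cuts to
  -- be distinct from each other and from the old ones.
  have h1 : S₁ ∉ insert S₂ (𝒮.image (π ⁻¹' ·)) := by
    obtain ⟨j, hj⟩ := hcross S₁ he.cut₁
    rw [Finset.mem_insert]
    rintro (rfl | hS)
    · exact he.disjoint j hj hj
    · exact hout _ hS j (he.inside₁ j hj) hj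
  have h2 : S₂ ∉ 𝒮.image (π ⁻¹' ·) := by
    obtain ⟨j, hj⟩ := hcross S₂ he.cut₂
    exact fun hS => hout _ hS j (he.inside₂ j hj) hj
  refine ⟨insert S₁ (insert S₂ (𝒮.image (π ⁻¹' ·))), ?_, fun a b => ?_, fun S hS => ?_,
    fun j S hS T hT hjS hjT => ?_⟩
  · rw [Finset.card_insert_of_notMem h1, Finset.card_insert_of_notMem h2,
      Finset.card_image_of_injective _ hπ.preimage_injective]
  · refine StarArc.reflTransGen_of_image (R := R) (by simp) (fun a b hab => ?_)
      (h.conn (π a) (π b)) a b rfl rfl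
    rcases (hfib a b).1 hab with rfl | ⟨ha, hb⟩
    · exact .refl
    · exact StarArc.mono (by simp) (he.conn a ha b hb)
  · rw [Finset.mem_insert, Finset.mem_insert] at hS
    rcases hS with rfl | rfl | hS
    · exact he.cut₁
    · exact he.cut₂
    · obtain ⟨S', hS', rfl⟩ := Finset.mem_image.1 hS
      obtain ⟨h1, h2⟩ := h.cut S' hS'
      refine ⟨h1.preimage hπ, fun h => h2 (hπ.preimage_injective ?_)⟩
      simpa using h
  · rw [Finset.mem_insert, Finset.mem_insert] at hS hT
    rcases hS with rfl | rfl | hS <;> rcases hT with rfl | rfl | hT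
    · rfl
    · exact absurd hjT (he.disjoint j hjS)
    · exact absurd hjT (hout T hT j (he.inside₁ j hjS))
    · exact absurd hjS (he.disjoint j hjT)
    · rfl
    · exact absurd hjT (hout T hT j (he.inside₂ j hjS))
    · exact absurd hjS (hout S hS j (he.inside₁ j hjT))
    · exact absurd hjS (hout S hS j (he.inside₂ j hjT))
    · obtain ⟨S', hS', rfl⟩ := Finset.mem_image.1 hS
      obtain ⟨T', hT', rfl⟩ := Finset.mem_image.1 hT
      rw [h.disjoint j S' hS' T' hT' ((starCrosses_preimage π).1 hjS)
        ((starCrosses_preimage π).1 hjT)]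

/-- Here `k` counts contracted ears: each costs at most one star more than the number of vertices it
removes, and adds two cuts. Contraction keeps the index type `J` and changes only `V`, hence the
quantification over `V` inside the induction. -/
theorem exists_isStarCutPair_of_card (n : ℕ) : ∀ (V : Type u) [Fintype V] [Nonempty V]
    (src : J → V) (snk : J → Set V), Fintype.card V = n →
    (∀ a b, StarArc src snk Set.univ a b → StarArc src snk Set.univ b a) →
    (∀ a b, ReflTransGen (StarArc src snk Set.univ) a b) →
    ∃ (k : ℕ) (R : Finset J) (𝒮 : Finset (Set V)),
      R.card + 1 ≤ n + k ∧ 𝒮.card = 2 * k ∧ IsStarCutPair src snk R 𝒮 := by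
  classical
  induction n using Nat.strong_induction_on with
  | _ n ih =>
    intro V _ _ src snk hn hA hconn
    rcases subsingleton_or_nontrivial V with hV | hV
    · refine ⟨0, ∅, ∅, ?_, rfl, fun a b => ?_, by simp, by simp⟩
      · have := Fintype.card_pos (α := V)
        simp; omega
      · rw [Subsingleton.elim a b]
    · obtain ⟨Q, R₀, S₁, S₂, he⟩ := exists_isStarEar hA hconn
      have hQ := he.one_lt_card
      obtain ⟨W, _, π, hπ, hfib, hcard⟩ :=
        Finset.exists_contraction (Finset.card_pos.1 (by omega : 0 < Q.card))
      have : Nonempty W := ⟨π (Classical.arbitrary V)⟩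
      obtain ⟨k, R, 𝒮, hR, h𝒮, h⟩ := ih (Fintype.card W) (by omega) W (π ∘ src)
        (fun j => π '' snk j) rfl
        (by
          rintro a b ⟨j, -, rfl, c, hc, rfl⟩
          exact (hA _ _ ⟨j, trivial, rfl, hc⟩).image π)
        (by
          intro a b
          obtain ⟨a, rfl⟩ := hπ a
          obtain ⟨b, rfl⟩ := hπ b
          exact (hconn a b).lift π fun _ _ h => h.image π)
      obtain ⟨𝒯, h𝒯, h'⟩ := he.uncontract hconn hπ hfib h
      refine ⟨k + 1, R ∪ R₀, 𝒯, ?_, by omega, h'⟩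
      have := Finset.card_union_le R R₀
      have := he.card_le
      omega

/-- In a bidirected, strongly connected family of stars there are a strongly connected subfamily
`R` and a family `𝒮` of cuts, no two of which are crossed by the same star, such that
`|R| ≤ 3/2 |𝒮|`. -/
theorem exists_isStarCutPair [Fintype V] (src : J → V) (snk : J → Set V)
    (hA : ∀ a b, StarArc src snk Set.univ a b → StarArc src snk Set.univ b a)
    (hconn : ∀ a b, ReflTransGen (StarArc src snk Set.univ) a b) :
    ∃ (R : Finset J) (𝒮 : Finset (Set V)),
      2 * R.card ≤ 3 * 𝒮.card ∧ IsStarCutPair src snk R 𝒮 := by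
  classical
  rcases subsingleton_or_nontrivial V with hV | hV
  · exact ⟨∅, ∅, by simp, fun a b => Subsingleton.elim a b ▸ .refl, by simp, by simp⟩
  obtain ⟨k, R, 𝒮, hR, h𝒮, h⟩ := exists_isStarCutPair_of_card _ V src snk rfl hA hconn
  -- From `|R| ≤ n - 1 + k`: if `2k < n`, then `2|R| < 3n` and all singletons are used; otherwise
  -- `2|R| < 6k`.
  rcases Nat.lt_or_ge (2 * k) (Fintype.card V) with hk | hk
  · refine ⟨R, Finset.univ.image fun v : V => {v}, ?_, h.conn, fun S hS => ?_,
      fun j S hS T hT hjS hjT => ?_⟩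
    · rw [Finset.card_image_of_injective _ Set.singleton_injective, Finset.card_univ]
      omega
    · obtain ⟨v, -, rfl⟩ := Finset.mem_image.1 hS
      obtain ⟨w, hw⟩ := exists_ne v
      exact singleton_cut hw.symm
    · obtain ⟨v, -, rfl⟩ := Finset.mem_image.1 hS
      obtain ⟨w, -, rfl⟩ := Finset.mem_image.1 hT
      rw [← show src j = v from hjS.1, ← show src j = w from hjT.1]
  · exact ⟨R, 𝒮, by omega, h⟩

end Contraction

/-! ### Cut programs -/

namespace CutProgram

variable {V : Type u} {J : Type v} [Fintype V] [Fintype J] (P : CutProgram V J)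

/-- Weak duality. -/
theorem dualValue_le_primalValue {x : J → ℝ} {y : Cut V → ℝ} (hx : P.PrimalFeasible x)
    (hy : P.DualFeasible y) : dualValue y ≤ P.primalValue x := by
  classical
  calc dualValue y ≤ ∑ S, y S * ∑ j with P.Crosses j S, x j :=
        Finset.sum_le_sum fun S _ => le_mul_of_one_le_right (hy.1 S) (by convert hx.2 S)
    _ = ∑ j, (∑ S with P.Crosses j S, y S) * x j := by
        simp only [Finset.mul_sum, Finset.sum_mul, Finset.sum_filter, mul_ite, mul_zero, ite_mul,
          zero_mul]
        exact Finset.sum_comm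
    _ ≤ P.primalValue x :=
        Finset.sum_le_sum fun j _ => mul_le_mul_of_nonneg_right (by convert hy.2 j) (hx.1 j)

theorem HasIntegerPrimalDualPair.gapRatio_le {P : CutProgram V J} {ρ : ℝ} (hρ : 0 ≤ ρ)
    (h : P.HasIntegerPrimalDualPair ρ) : P.gapRatio ≤ ENNReal.ofReal ρ := by
  obtain ⟨x, y, hx, hxi, hy, -, hxy⟩ := h
  refine ENNReal.div_le_of_le_mul ?_
  have h1 : P.integerOpt ≤ ENNReal.ofReal (P.primalValue x) := iInf₂_le x ⟨hx, hxi⟩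
  have h2 : ENNReal.ofReal (dualValue y) ≤ P.fractionalOpt :=
    le_iInf₂ fun z hz => ENNReal.ofReal_le_ofReal (P.dualValue_le_primalValue hz hy)
  calc P.integerOpt ≤ ENNReal.ofReal (ρ * dualValue y) := h1.trans (ENNReal.ofReal_le_ofReal hxy)
    _ = ENNReal.ofReal ρ * ENNReal.ofReal (dualValue y) := ENNReal.ofReal_mul hρ
    _ ≤ ENNReal.ofReal ρ * P.fractionalOpt := by gcongr

/-- A set of indices crossing all cuts and a family of cuts, no two of which are crossed by the
same index, give an integer primal and an integer dual solution. -/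
theorem hasIntegerPrimalDualPair_of_finset {X : Finset J} {𝒴 : Finset (Cut V)} {ρ : ℝ}
    (hcost : ∀ j, 0 ≤ P.cost j) (hX : ∀ S, ∃ j ∈ X, P.Crosses j S)
    (h𝒴 : ∀ j, ∀ S ∈ 𝒴, P.Crosses j S → 1 ≤ P.cost j)
    (hdisj : ∀ j, ∀ S ∈ 𝒴, ∀ T ∈ 𝒴, P.Crosses j S → P.Crosses j T → S = T)
    (hle : ∑ j ∈ X, P.cost j ≤ ρ * 𝒴.card) : P.HasIntegerPrimalDualPair ρ := by
  classical
  refine ⟨fun j => if j ∈ X then 1 else 0, fun S => if S ∈ 𝒴 then 1 else 0,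
    ⟨fun j => ?_, fun S => ?_⟩, fun j => ?_, ⟨fun S => ?_, fun j => ?_⟩, fun S => ?_, ?_⟩
  · dsimp only; split_ifs <;> norm_num
  · obtain ⟨j, hj, hjS⟩ := hX S
    calc (1 : ℝ) = if j ∈ X then 1 else 0 := by rw [if_pos hj]
      _ ≤ _ := Finset.single_le_sum (f := fun j => if j ∈ X then (1 : ℝ) else 0)
          (fun j _ => by split_ifs <;> norm_num)
          (Finset.mem_filter.2 ⟨Finset.mem_univ j, hjS⟩)
  · dsimp only; split_ifs
    · exact ⟨1, by simp⟩
    · exact ⟨0, by simp⟩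
  · dsimp only; split_ifs <;> norm_num
  · by_cases h : ∃ S ∈ 𝒴, P.Crosses j S
    · obtain ⟨S, hS, hjS⟩ := h
      refine le_trans (le_of_eq ?_) (h𝒴 j S hS hjS)
      rw [Finset.sum_eq_single S, if_pos hS]
      · intro T hT hTS
        rw [if_neg fun hT' => hTS (hdisj j T hT' S hS (Finset.mem_filter.1 hT).2 hjS)]
      · exact fun hn => absurd (Finset.mem_filter.2 ⟨Finset.mem_univ S, hjS⟩) hn
    · refine le_trans (le_of_eq (Finset.sum_eq_zero fun S hS => ?_)) (hcost j)
      rw [if_neg fun hS' => h ⟨S, hS', (Finset.mem_filter.1 hS).2⟩]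
  · dsimp only; split_ifs
    · exact ⟨1, by simp⟩
    · exact ⟨0, by simp⟩
  · simpa [primalValue, dualValue, Finset.sum_ite_mem] using hle

end CutProgram

/-! ### Integer primal-dual pairs for the two programs -/

open Relation

theorem SSCInstance.hasIntegerPrimalDualPair (I : SSCInstance.{u}) (hI : IsBidirected I.G) :
    I.program.HasIntegerPrimalDualPair (3 / 2) := by
  classical
  have harc : ∀ a b, StarArc (fun F : I.stars => F.1.source) (fun F => (F.1.sinks : Set I.V))
      Set.univ a b ↔ I.G.Adj a b := fun a b => by
    rw [I.adj_iff]
    exact ⟨fun ⟨F, _, h1, h2⟩ => ⟨F.1, F.2, h1, h2⟩,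
      fun ⟨F, hF, h1, h2⟩ => ⟨⟨F, hF⟩, trivial, h1, h2⟩⟩
  obtain ⟨R, 𝒮, hcard, hconn, hcut, hdisj⟩ := exists_isStarCutPair
    (fun F : I.stars => F.1.source) (fun F => (F.1.sinks : Set I.V))
    (fun a b h => (harc b a).2 ((hI a b).1 ((harc a b).1 h)))
    (fun a b => (I.stronglyConnected a b).lift id fun a b h => (harc a b).2 h)
  refine I.program.hasIntegerPrimalDualPair_of_finset (X := R)
    (𝒴 := 𝒮.subtype fun S => S.Nonempty ∧ S ≠ Set.univ)
    (fun _ => zero_le_one) (fun S => ?_) (fun _ _ _ _ => le_rfl)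
    (fun j S hS T hT hjS hjT => ?_) ?_
  · obtain ⟨a, ha⟩ := S.2.1
    obtain ⟨b, hb⟩ := (Set.ne_univ_iff_exists_notMem S.1).1 S.2.2
    exact exists_starCrosses (hconn a b) ha hb
  · exact Subtype.ext (hdisj j S.1 (Finset.mem_subtype.1 hS) T.1 (Finset.mem_subtype.1 hT) hjS hjT)
  · have : (2 : ℝ) * R.card ≤ 3 * 𝒮.card := by exact_mod_cast hcard
    rw [Finset.card_subtype, Finset.filter_true_of_mem hcut]
    simp only [SSCInstance.program, Finset.sum_const, nsmul_eq_mul, mul_one]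
    linarith

/-- The arcs that are available at power `0`. -/
def DPAInstance.ZeroArc (I : DPAInstance.{u}) (a b : I.V) : Prop := b ∈ I.reach a 0

theorem DPAInstance.ZeroArc.symm {I : DPAInstance.{u}} {a b : I.V} (h : I.ZeroArc a b) :
    I.ZeroArc b a :=
  ⟨(I.bidirected a b).1 h.1, I.cost_symm a b h.1 ▸ h.2⟩

/-- Two vertices are equivalent if they are connected by arcs available at power `0`. -/
def DPAInstance.zeroSetoid (I : DPAInstance.{u}) : Setoid I.V where
  r := ReflTransGen I.ZeroArc
  iseqv := ⟨fun _ => .refl, fun h => by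
    induction h with
    | refl => exact .refl
    | tail _ h ih => exact ih.head h.symm, fun h h' => h.trans h'⟩

/-- Vertices joined by cost-0 arcs are connected for free. In the quotient by these components,
raising a vertex to high power buys the star of all its arcs. -/
theorem DPAInstance.hasIntegerPrimalDualPair (I : DPAInstance.{u}) :
    I.program.HasIntegerPrimalDualPair (3 / 2) := by
  classical
  set π : I.V → Quotient I.zeroSetoid := Quotient.mk I.zeroSetoid with hπdef
  have hπ : Function.Surjective π := Quotient.mk_surjective
  have hzero : ∀ a b, I.ZeroArc a b → π a = π b :=
    fun a b h => Quotient.sound (ReflTransGen.single h)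
  have harc : ∀ a b, I.G.Adj a b →
      StarArc π (fun a => π '' {b | I.G.Adj a b}) Set.univ (π a) (π b) :=
    fun a b h => ⟨a, trivial, rfl, b, h, rfl⟩
  obtain ⟨R, 𝒮, hcard, hconn, hcut, hdisj⟩ := exists_isStarCutPair π
    (fun a => π '' {b | I.G.Adj a b})
    (by
      rintro _ _ ⟨a, -, rfl, b, h, rfl⟩
      exact harc b a ((I.bidirected a b).1 h))
    (by
      intro x y
      obtain ⟨a, rfl⟩ := hπ x
      obtain ⟨b, rfl⟩ := hπ y
      exact (I.stronglyConnected a b).lift π harc)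
  -- Cost-0 arcs stay inside a class, so only high power crosses a pulled-back cut.
  have hcross : ∀ (j : I.V × Fin 2) (S : Set (Quotient I.zeroSetoid)),
      (j.1 ∈ π ⁻¹' S ∧ ∃ b ∈ I.reach j.1 j.2, b ∉ π ⁻¹' S) →
      j.2 = 1 ∧ StarCrosses π (fun a => π '' {b | I.G.Adj a b}) j.1 S := by
    rintro ⟨a, p⟩ S ⟨ha, b, hb, hbS⟩
    refine ⟨?_, ha, π b, ⟨b, hb.1, rfl⟩, hbS⟩
    by_contra hp
    obtain rfl : p = 0 := by
      change ¬ p = 1 at hp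
      omega
    exact hbS (by simpa [← hzero a b hb] using ha)
  refine I.program.hasIntegerPrimalDualPair_of_finset
    -- Low power everywhere is free and covers every cut crossed by a cost-0 arc.
    (X := Finset.univ.image (fun a : I.V => (a, (0 : Fin 2))) ∪ R.image fun a => (a, (1 : Fin 2)))
    (𝒴 := (𝒮.image (π ⁻¹' ·)).subtype fun S => S.Nonempty ∧ S ≠ Set.univ)
    (fun _ => Nat.cast_nonneg _) (fun S => ?_) (fun j S hS hjS => ?_)
    (fun j S hS T hT hjS hjT => ?_) ?_
  · by_cases hS : ∃ a ∈ S.1, ∃ b ∈ I.reach a 0, b ∉ S.1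
    · obtain ⟨a, ha, b, hb, hbS⟩ := hS
      exact ⟨(a, 0), by simp, ha, b, hb, hbS⟩
    · push Not at hS
      -- A cut crossed by no cost-0 arc is a union of classes, so it descends to a cut of the
      -- quotient, which a star of `R` crosses.
      have hsat : ∀ a b, π a = π b → a ∈ S.1 → b ∈ S.1 := by
        intro a b hab ha
        have h : ReflTransGen I.ZeroArc a b := Quotient.exact hab
        induction h with
        | refl => exact ha
        | tail hc h ih => exact hS _ (ih (Quotient.sound hc)) _ h
      have himg : ∀ a, π a ∈ π '' S.1 → a ∈ S.1 := fun a ⟨b, hb, hba⟩ => hsat b a hba hb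
      obtain ⟨a, ha⟩ := S.2.1
      obtain ⟨b, hb⟩ := (Set.ne_univ_iff_exists_notMem S.1).1 S.2.2
      obtain ⟨c, hc, hcS, _, ⟨d, hd, rfl⟩, hdS⟩ := exists_starCrosses (hconn (π a) (π b))
        (S := π '' S.1) ⟨a, ha, rfl⟩ fun h => hb (himg b h)
      exact ⟨(c, 1), by simp [Finset.mem_coe.1 hc], himg c hcS, d,
        ⟨hd, by show _ ≤ (1 : Fin 2); omega⟩, fun h => hdS ⟨d, h, rfl⟩⟩
  · obtain ⟨S', -, (hS' : π ⁻¹' S' = S.1)⟩ := Finset.mem_image.1 (Finset.mem_subtype.1 hS)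
    have := (hcross j S' (hS' ▸ hjS)).1
    simp [DPAInstance.program, this]
  · obtain ⟨S', hS', (hSS' : π ⁻¹' S' = S.1)⟩ :=
      Finset.mem_image.1 (Finset.mem_subtype.1 hS)
    obtain ⟨T', hT', (hTT' : π ⁻¹' T' = T.1)⟩ :=
      Finset.mem_image.1 (Finset.mem_subtype.1 hT)
    have h1 := (hcross j S' (hSS' ▸ hjS)).2
    have h2 := (hcross j T' (hTT' ▸ hjT)).2
    apply Subtype.ext
    rw [← hSS', ← hTT', hdisj j.1 S' hS' T' hT' h1 h2]
  · have hcard' : (2 : ℝ) * R.card ≤ 3 * 𝒮.card := by exact_mod_cast hcard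
    rw [Finset.card_subtype, Finset.filter_true_of_mem, Finset.card_image_of_injective _
      hπ.preimage_injective, Finset.sum_union, Finset.sum_image, Finset.sum_image]
    · simp only [DPAInstance.program, Fin.val_zero, Nat.cast_zero, Finset.sum_const_zero,
        Fin.val_one, Nat.cast_one, Finset.sum_const, nsmul_eq_mul, mul_one, zero_add]
      linarith
    · exact fun a _ b _ h => (Prod.ext_iff.1 h).1
    · exact fun a _ b _ h => (Prod.ext_iff.1 h).1
    · rw [Finset.disjoint_left]
      simp
    · intro S hS
      obtain ⟨S', hS', rfl⟩ := Finset.mem_image.1 hS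
      obtain ⟨h1, h2⟩ := hcut S' hS'
      exact ⟨h1.preimage hπ, fun h => h2 (hπ.preimage_injective (by simpa using h))⟩

theorem mainTheorem3 :
    (dpaIntegralityGap.{u} ≤ 3 / 2 ∧
      ∀ I : DPAInstance.{u}, I.program.HasIntegerPrimalDualPair (3 / 2)) ∧
    (bidirectedSSCIntegralityGap.{u} ≤ 3 / 2 ∧
      ∀ I : SSCInstance.{u}, IsBidirected I.G →
        I.program.HasIntegerPrimalDualPair (3 / 2)) := by
  have h32 : ENNReal.ofReal (3 / 2) = 3 / 2 := by
    rw [ENNReal.ofReal_div_of_pos (by norm_num)]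
    simp
  refine ⟨⟨iSup_le fun I => ?_, fun I => I.hasIntegerPrimalDualPair⟩,
    iSup₂_le fun I hI => ?_, fun I hI => I.hasIntegerPrimalDualPair hI⟩
  · exact h32 ▸ I.hasIntegerPrimalDualPair.gapRatio_le (by norm_num)
  · exact h32 ▸ (I.hasIntegerPrimalDualPair hI).gapRatio_le (by norm_num)
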